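/- **Setting.** Let $\tau=(a,b,c)$ be integers with $2\le a\le b\le c<\infty$ and $\frac1a+\frac1b+\frac1c<1$, let $\overline{\Delta}(\tau)=\langle x,y\mid x^a=y^b=(xy)^c=1\rangle$ be the triangle group, and let $\Delta(\tau)\subset \mathrm{SL}_2(\mathbb{R})$ be the group generated by $$X=\begin{pmatrix}\cos\frac{\pi}{a}&\sin\frac{\pi}{a}\\-\sin\frac{\pi}{a}&\cos\frac{\pi}{a}\end{pmatrix},\qquad Y=\begin{pmatrix}1&0\\0&t\end{pmatrix}^{-1}\begin{pmatrix}\cos\frac{\pi}{b}&\sin\frac{\pi}{b}\\-\sin\frac{\pi}{b}&\cos\frac{\pi}{b}\end{pmatrix}\begin{pmatrix}1&0\\0&t\end{pmatrix},$$ where $t$ is the larger root of $t^2-2\,\frac{\cos\frac\pi a\cos\frac\pi b+\cos\frac\pi c}{\sin\frac\pi a\sin\frac\pi b}\,t+1=0$. Then $\Delta(\tau)/\{\pm1\}\simeq\overline\Delta(\tau)$ with $X\mapsto x$, $Y\mapsto y$. Let $F=\mathbb{Q}(\cos\frac\pi a,\cos\frac\pi b,\cos\frac\pi c)$ and let $\mathcal{O}=\mathcal{O}_F[\Delta(\tau)]\subset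 \mathrm{M}_2(\mathbb{R})$, an order in the quaternion algebra $F[\Delta(\tau)]$. Let $p>2$ be a prime number, let $\mathfrak{P}$ be a prime ideal of $\mathcal{O}_F$ above $p$ that does not divide the discriminant of $\mathcal{O}$ (this is automatic if $p\nmid abc$), let $\mathbb{F}_q=\mathcal{O}_F/\mathfrak{P}$, and fix an isomorphism of $\mathbb{F}_q$-algebras $\mathcal{O}/\mathfrak{P}\mathcal{O}\simeq \mathrm{M}_2(\mathbb{F}_q)$. Let $\pi:\mathrm{SL}_2(\mathbb{F}_q)\to\mathrm{PSL}_2(\mathbb{F}_q)$ be the projection, and let $K(\tau;p)\le \mathrm{PSL}_2(\mathbb{F}_q)$ be the image of $\overline{\Delta}(\tau)=\Delta(\tau)/\{\pm1\}$ under reduction modulo $\mathfrak{P}$. **Trace triples.** For $\underline t\in\mathbb{F}_q^3$ let $T(\underline t)$ be the set of $\underline g=(g_1,g_2,g_3)\in\mathrm{SL}_2(\mathbb{F}_q)^3$ with $g_1g_2g_3=1$ and $\mathrm{tr}\,g_i=t_i$ for all $i$. Let $o(\underline g)$ be the triple of the orders of $\pi(g_1),\pi(g_2),\pi(g_3)$,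 arranged in non-descending order. The triple $\underline t$ is *exceptional* if some $\underline g\in T(\underline t)$ has $o(\underline g)$ equal to $(2,2,n)$ with $n\ge2$ or to one of $(2,3,3),(2,3,4),(2,3,5),(2,5,5),(3,3,3),(3,3,5),(3,4,4),(3,5,5),(5,5,5)$; it is *projective* if for every $\underline g\in T(\underline t)$ the group $\pi(\langle g_1,g_2,g_3\rangle)$ is isomorphic to $\mathrm{PSL}_2(l)$ or $\mathrm{PGL}_2(l)$ for some subfield $l\subseteq\mathbb{F}_q$. For a triple $\underline C=(C_1,C_2,C_3)$ of conjugacy classes of $\mathrm{PSL}_2(\mathbb{F}_q)$, let $\mathrm{tr}\,\underline C=(\pm t_1,\pm t_2,\pm t_3)$ be its triple of traces, each defined up to sign; its lifts are the triples $(\pm t_1,\pm t_2,\pm t_3)$ in $\mathbb{F}_q^3$, with independent signs. It is *partly projective* if it has a projective lift, and *exceptional* if it has an exceptional lift. **Counting data.** Let $\mathcal{C}(\tau;p)$ be the set of $\underline C$ for which there are $\gamma_i\in C_i$ with $\gamma_1\gamma_2\gamma_3=\gamma_1^a=\gamma_2^b=\gamma_3^c=1$ and $\langle\gamma_1,\gamma_2,\gamma_3\rangle=K(\tau;p)$.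 Let $o(\underline C)$ be the triple of the orders of the elements of $C_1,C_2,C_3$, arranged in non-descending order, and let $\Omega(\tau;p)=\{o(\underline C):\underline C\in\mathcal{C}(\tau;p)\}$. For $\omega\in\Omega(\tau;p)$ let $m(\omega)$ be the number of distinct triples obtained by rearranging $\omega$ that occur, with the components in their original order, as the triple of orders of elements of $(C_1,C_2,C_3)$ for some $\underline C\in\mathcal{C}(\tau;p)$. Thus $1\le m(\omega)\le6$. Let $\kappa(n,q)$ be the number of conjugacy classes of $\mathrm{PSL}_2(\mathbb{F}_q)$ whose elements have order $n$. **Proposition.** Suppose that for every $\underline C\in\mathcal{C}(\tau;p)$ the triple $\mathrm{tr}\,\underline C$ is partly projective and not exceptional, and that its components generate $\mathbb{F}_q$ over $\mathbb{F}_p$. Then the set $\mathcal{N}(\tau;p)$ of normal subgroups $H\trianglelefteq\overline\Delta(\tau)$ with $\overline\Delta(\tau)/H\simeq K(\tau;p)$ is finite, and $$|\mathcal{N}(\tau;p)|\le\sum_{\substack{\omega=(a',b',c')\in\Omega(\tau;p)\\a'=2}}m(\omega)\,\kappa(a',q)\,\kappa(b',q)\,\kappa(c',q)+\sum_{\substack{\omega=(a',b',c')\in\Omega(\tau;p)\\a'>2}}2\,m(\omega)\,\kappa(a',q)\,\kappa(b',q)\,\kappa(c',q).$$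 -/

import Mathlib

open scoped NumberField

/-- A hyperbolic triple `τ = (a, b, c)` with `2 ≤ a ≤ b ≤ c < ∞`. -/
structure HyperbolicTriple where
  a : ℕ
  b : ℕ
  c : ℕ
  two_le_a : 2 ≤ a
  a_le_b : a ≤ b
  b_le_c : b ≤ c
  hyperbolic : (1 / a + 1 / b + 1 / c : ℚ) < 1

/-- `SL₂(k)`. -/
abbrev SL2 (k : Type*) [CommRing k] : Type _ := Matrix.SpecialLinearGroup (Fin 2) k

/-- `PSL₂(k)`, the quotient of `SL₂(k)` by its center `{±1}`. -/
abbrev PSL2 (k : Type*) [CommRing k] : Type _ := Matrix.ProjectiveSpecialLinearGroup (Fin 2) k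

/-- `PGL₂(k)`. -/
abbrev PGL2 (k : Type*) [CommRing k] : Type _ := Matrix.ProjGenLinGroup (Fin 2) k

/-- The natural projection `π : SL₂(k) → PSL₂(k)`. -/
def projPSL (k : Type*) [CommRing k] : SL2 k →* PSL2 k :=
  QuotientGroup.mk' (Subgroup.center (SL2 k))

namespace HyperbolicTriple

noncomputable section

/-- The relators `x ^ a`, `y ^ b`, `(x y) ^ c`. -/
def triangleRels (τ : HyperbolicTriple) : Set (FreeGroup (Fin 2)) :=
  {FreeGroup.of 0 ^ τ.a, FreeGroup.of 1 ^ τ.b, (FreeGroup.of 0 * FreeGroup.of 1) ^ τ.c}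

/-- The triangle group `⟨x, y | x ^ a = y ^ b = (x y) ^ c = 1⟩`. -/
abbrev TriangleGroup (τ : HyperbolicTriple) : Type := PresentedGroup τ.triangleRels

/-- The trace field `F_τ = ℚ(cos (π / a), cos (π / b), cos (π / c))`. -/
def traceField (τ : HyperbolicTriple) : IntermediateField ℚ ℝ :=
  IntermediateField.adjoin ℚ
    {Real.cos (Real.pi / τ.a), Real.cos (Real.pi / τ.b), Real.cos (Real.pi / τ.c)}

/-- The number `(cos (π/a) cos (π/b) + cos (π/c)) / (sin (π/a) sin (π/b))`. -/
def halfSum (τ : HyperbolicTriple) : ℝ :=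
  (Real.cos (Real.pi / τ.a) * Real.cos (Real.pi / τ.b) + Real.cos (Real.pi / τ.c)) /
    (Real.sin (Real.pi / τ.a) * Real.sin (Real.pi / τ.b))

/-- The larger root `t` of `t ^ 2 - 2 * halfSum * t + 1 = 0`. -/
def root (τ : HyperbolicTriple) : ℝ := τ.halfSum + √(τ.halfSum ^ 2 - 1)

theorem three_le_c (τ : HyperbolicTriple) : 3 ≤ τ.c := by
  by_contra h
  have h1 := τ.two_le_a
  have h2 := τ.a_le_b
  have h3 := τ.b_le_c
  have h4 := τ.hyperbolic
  have e1 : τ.a = 2 := by omega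
  have e2 : τ.b = 2 := by omega
  have e3 : τ.c = 2 := by omega
  rw [e1, e2, e3] at h4
  norm_num at h4

theorem cos_nonneg_of_two_le {n : ℕ} (hn : 2 ≤ n) : 0 ≤ Real.cos (Real.pi / n) := by
  have h : (2 : ℝ) ≤ n := by exact_mod_cast hn
  have hp := Real.pi_pos
  have h0 : 0 ≤ Real.pi / n := by positivity
  apply Real.cos_nonneg_of_neg_pi_div_two_le_of_le
  · linarith
  · gcongr

theorem sin_pos_of_two_le {n : ℕ} (hn : 2 ≤ n) : 0 < Real.sin (Real.pi / n) := by
  have h : (2 : ℝ) ≤ n := by exact_mod_cast hn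
  have hp := Real.pi_pos
  apply Real.sin_pos_of_pos_of_lt_pi
  · positivity
  · rw [div_lt_iff₀ (by linarith)]
    nlinarith

theorem halfSum_pos (τ : HyperbolicTriple) : 0 < τ.halfSum := by
  have ha := τ.two_le_a
  have hb := τ.a_le_b
  have hc : (3 : ℝ) ≤ τ.c := by exact_mod_cast τ.three_le_c
  have hp := Real.pi_pos
  have h0 : 0 ≤ Real.pi / τ.c := by positivity
  have hcos : 0 < Real.cos (Real.pi / τ.c) := by
    apply Real.cos_pos_of_mem_Ioo
    constructor
    · linarith
    · rw [div_lt_iff₀ (by linarith)]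
      nlinarith
  have h1 := cos_nonneg_of_two_le ha
  have h2 := cos_nonneg_of_two_le (ha.trans hb)
  have h3 := sin_pos_of_two_le ha
  have h4 := sin_pos_of_two_le (ha.trans hb)
  unfold halfSum
  positivity

theorem root_ne_zero (τ : HyperbolicTriple) : τ.root ≠ 0 :=
  (add_pos_of_pos_of_nonneg τ.halfSum_pos (Real.sqrt_nonneg _)).ne'

/-- The rotation matrix of angle parameter `θ`. -/
def rotation (θ : ℝ) : Matrix (Fin 2) (Fin 2) ℝ :=
  !![Real.cos θ, Real.sin θ; -Real.sin θ, Real.cos θ]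

/-- The matrix `ι(x)`. -/
def iotaX (τ : HyperbolicTriple) : SL2 ℝ :=
  ⟨rotation (Real.pi / τ.a), by
    simp only [rotation, Matrix.det_fin_two_of]
    nlinarith [Real.sin_sq_add_cos_sq (Real.pi / τ.a)]⟩

/-- The matrix `ι(y)`. -/
def iotaY (τ : HyperbolicTriple) : SL2 ℝ :=
  ⟨(!![1, 0; 0, τ.root])⁻¹ * rotation (Real.pi / τ.b) * !![1, 0; 0, τ.root], by
    have hD : IsUnit (!![1, 0; 0, τ.root] : Matrix (Fin 2) (Fin 2) ℝ) := by
      rw [Matrix.isUnit_iff_isUnit_det]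
      simpa [Matrix.det_fin_two_of] using τ.root_ne_zero
    rw [Matrix.det_conj' hD]
    simp only [rotation, Matrix.det_fin_two_of]
    nlinarith [Real.sin_sq_add_cos_sq (Real.pi / τ.b)]⟩

/-- The image in `SL₂(ℝ)` of the extended triangle group under the embedding `ι`. It contains
`-1 = ι(x) ^ a`, and its image in `PSL₂(ℝ)` is the triangle group. -/
def extendedTriangleGroup (τ : HyperbolicTriple) : Subgroup (SL2 ℝ) :=
  Subgroup.closure {τ.iotaX, τ.iotaY}

/-- The order `𝓞_F[ι(Δ)]` in the quaternion algebra `F[ι(Δ)] ⊆ M₂(ℝ)`, for `F` the trace field. -/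
def quaternionOrder (τ : HyperbolicTriple) :
    Subalgebra (𝓞 τ.traceField) (Matrix (Fin 2) (Fin 2) ℝ) :=
  Algebra.adjoin (𝓞 τ.traceField)
    ((fun g : SL2 ℝ => (g : Matrix (Fin 2) (Fin 2) ℝ)) '' τ.extendedTriangleGroup)

/-- An element of the extended triangle group, as an element of the order. -/
def toOrder (τ : HyperbolicTriple) (γ : τ.extendedTriangleGroup) : τ.quaternionOrder :=
  ⟨((γ : SL2 ℝ) : Matrix (Fin 2) (Fin 2) ℝ), Algebra.subset_adjoin ⟨γ, γ.2, rfl⟩⟩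

end

end HyperbolicTriple

noncomputable section

section Triples

variable {k : Type*} [Field k]

/-- `κ(n, q)` for `q = #k`: the number of conjugacy classes of `PSL₂(k)` whose elements have
order `n`. -/
def kappa (n : ℕ) (k : Type*) [Field k] : ℕ :=
  {C : ConjClasses (PSL2 k) | ∀ g ∈ C.carrier, orderOf g = n}.ncard

/-- The rearrangement of a triple of natural numbers in non-descending order. -/
def sortTriple (f : Fin 3 → ℕ) : Fin 3 → ℕ := f ∘ Tuple.sort f

/-- `T(t)`: the triples `g` in `SL₂(k)` with `g₁ g₂ g₃ = 1` and traces `t₁, t₂, t₃`. -/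
def traceFiber (t : Fin 3 → k) : Set (Fin 3 → SL2 k) :=
  {g | g 0 * g 1 * g 2 = 1 ∧ ∀ i, (g i : Matrix (Fin 2) (Fin 2) k).trace = t i}

/-- The order triple `o(g)`. -/
def orderTriple (g : Fin 3 → SL2 k) : Fin 3 → ℕ :=
  sortTriple fun i => orderOf (projPSL k (g i))

/-- The order triples that make a trace triple exceptional. -/
def exceptionalOrders : Set (Fin 3 → ℕ) :=
  {ω | ∃ n, 2 ≤ n ∧ ω = ![2, 2, n]} ∪
    {![2, 3, 3], ![2, 3, 4], ![2, 3, 5], ![2, 5, 5], ![3, 3, 3], ![3, 3, 5], ![3, 4, 4],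
      ![3, 5, 5], ![5, 5, 5]}

/-- Exceptional trace triples. -/
def IsExceptional (t : Fin 3 → k) : Prop :=
  ∃ g ∈ traceFiber t, orderTriple g ∈ exceptionalOrders

/-- Projective trace triples. -/
def IsProjective (t : Fin 3 → k) : Prop :=
  ∀ g ∈ traceFiber t, ∃ l : Subfield k,
    Nonempty ((Subgroup.closure (Set.range g)).map (projPSL k) ≃* PSL2 l) ∨
    Nonempty ((Subgroup.closure (Set.range g)).map (projPSL k) ≃* PGL2 l)

/-- The trace triple up to signs of a triple of conjugacy classes of `PSL₂(k)`, given as the set of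
all its lifts `(±t₁, ±t₂, ±t₃)`, with independent signs. -/
def traceLifts (C : Fin 3 → ConjClasses (PSL2 k)) : Set (Fin 3 → k) :=
  {t | ∀ i, ∃ g : SL2 k, ConjClasses.mk (projPSL k g) = C i ∧
    (g : Matrix (Fin 2) (Fin 2) k).trace = t i}

/-- The trace triple up to signs of `C` is partly projective. -/
def IsPartlyProjectiveClass (C : Fin 3 → ConjClasses (PSL2 k)) : Prop :=
  ∃ t ∈ traceLifts C, IsProjective t

/-- The trace triple up to signs of `C` is exceptional. -/
def IsExceptionalClass (C : Fin 3 → ConjClasses (PSL2 k)) : Prop :=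
  ∃ t ∈ traceLifts C, IsExceptional t

/-- The subfield of `k` generated over the prime field by the components of the trace triple. -/
def classTraceField (C : Fin 3 → ConjClasses (PSL2 k)) : Subfield k :=
  Subfield.closure {x | ∃ t ∈ traceLifts C, ∃ i, t i = x}

/-- The common order of the elements of a conjugacy class. -/
def classOrder {G : Type*} [Group G] : ConjClasses G → ℕ :=
  Quotient.lift orderOf fun _ _ h => h.elim fun c hc => SemiconjBy.orderOf_eq (c : G) hc

end Triples

namespace HyperbolicTriple

variable (τ : HyperbolicTriple) {k : Type*} [Field k] [Algebra (𝓞 τ.traceField) k]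
  (φ : τ.quaternionOrder →ₐ[𝓞 τ.traceField] Matrix (Fin 2) (Fin 2) k)

/-- `K(τ; p)`, viewed in `PSL₂(k)`: the image of the triangle group under reduction of the order
modulo a prime `𝔓` with residue field `k`. When `φ` is surjective, it induces an identification of
the reduced order with `M₂(k)`; reduced norms then go to determinants, so that `φ γ` lies in
`SL₂(k)` for every `γ` in the extended triangle group. -/
def quotientGroup : Subgroup (PSL2 k) :=
  Subgroup.closure
    {x | ∃ (γ : τ.extendedTriangleGroup) (g : SL2 k),
      (g : Matrix (Fin 2) (Fin 2) k) = φ (τ.toOrder γ) ∧ projPSL k g = x}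

/-- `T(τ; p)`: the triples that generate `K(τ; p)` and satisfy the relations of the triangle
group. -/
def generatingTriples : Set (Fin 3 → PSL2 k) :=
  {γ | γ 0 ^ τ.a = 1 ∧ γ 1 ^ τ.b = 1 ∧ γ 2 ^ τ.c = 1 ∧ γ 0 * γ 1 * γ 2 = 1 ∧
    Subgroup.closure (Set.range γ) = τ.quotientGroup φ}

/-- `Σ(C)`: the triples with product `1` and components in the given classes that generate
`K(τ; p)`. -/
def classFiber (C : Fin 3 → ConjClasses (PSL2 k)) : Set (Fin 3 → PSL2 k) :=
  {γ | γ 0 * γ 1 * γ 2 = 1 ∧ (∀ i, ConjClasses.mk (γ i) = C i) ∧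
    Subgroup.closure (Set.range γ) = τ.quotientGroup φ}

/-- `𝒞(τ; p)`: the triples of conjugacy classes that contain an element of `T(τ; p)`. -/
def classTriples : Set (Fin 3 → ConjClasses (PSL2 k)) :=
  {C | (τ.classFiber φ C ∩ τ.generatingTriples φ).Nonempty}

/-- `Ω(τ; p)`, the set of non-descending order triples `o(C)` for `C` in `𝒞(τ; p)`. -/
def orderTriples : Set (Fin 3 → ℕ) :=
  {ω | ∃ C ∈ τ.classTriples φ, sortTriple (fun i => classOrder (C i)) = ω}

/-- `m(ω)`: the number of rearrangements of `ω` that occur as the order triple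
`(o(C₁), o(C₂), o(C₃))` of some `C` in `𝒞(τ; p)`, in the given order of the components. -/
def orderMultiplicity (ω : Fin 3 → ℕ) : ℕ :=
  {f : Fin 3 → ℕ | sortTriple f = ω ∧
    ∃ C ∈ τ.classTriples φ, (fun i => classOrder (C i)) = f}.ncard

/-- `𝒩(τ; p)`: the normal subgroups of the triangle group with quotient isomorphic to
`K(τ; p)`. -/
def normalSubgroups : Set (Subgroup τ.TriangleGroup) :=
  {H | ∃ _ : H.Normal, Nonempty (τ.TriangleGroup ⧸ H ≃* τ.quotientGroup φ)}

end HyperbolicTriple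

end

/-! A normal subgroup with quotient $K(\tau;p)$ is the kernel of a homomorphism $f$ from the
triangle group onto $K(\tau;p)\le\mathrm{PSL}_2(k)$. The images of $x$, $y$, $(xy)^{-1}$ give a
class triple $\underline C$. Lifts $A,B\in\mathrm{SL}_2(k)$ of the first two can be signed to have
the traces chosen for $C_1,C_2$; then $\mathrm{tr}(AB)$ is the trace chosen for $C_3$ up to one
sign. The point is that $\underline C$ and this sign determine $\ker f$
(`ker_le_ker_of_hasLiftWithTraces`).

Indeed, if $(A',B')$ has the same three traces, the algebra generated by $(A,A')$ and $(B,B')$ in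
$\mathrm M_2(k)^2$ has dimension at most $4$. Since $A,B$ generate $\mathrm M_2(k)$
(`adjoin_eq_top_of_generates`), its first projection is an isomorphism, so a word equal to $\pm1$ in
$A,B$ equals the same sign in $A',B'$ (`projPSL_lift_eq_one_of_trace_eq`).

An element of order $2$ has trace $0$, which absorbs the sign; otherwise the sign costs a factor
$2$. The class triples are then counted by their orders. -/

open Matrix

/-! ### Algebras generated by two elements with prescribed traces -/

section Algebra

/-- If `a` and `b` satisfy the quadratic relations of a pair in `SL₂` with prescribed traces, then
`1, a, b, ab` span the algebra they generate. -/
theorem Algebra.adjoin_pair_le_span_of_trace_relations {k R : Type*} [Field k] [Ring R]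
    [Algebra k R] {a b : R} {s t u : k} (ha : a * a = s • a - 1) (hb : b * b = t • b - 1)
    (hab : b * a = s • b + t • a + u • (1 : R) - a * b) :
    Subalgebra.toSubmodule (Algebra.adjoin k {a, b}) ≤ Submodule.span k {1, a, b, a * b} := by
  set S := Submodule.span k ({1, a, b, a * b} : Set R) with hS
  have m1 : (1 : R) ∈ S := Submodule.subset_span (by simp)
  have ma : a ∈ S := Submodule.subset_span (by simp)
  have mb : b ∈ S := Submodule.subset_span (by simp)
  have mab : a * b ∈ S := Submodule.subset_span (by simp)
  -- Left multiplication by `x` is linear, so stability of `S` is tested on the four spanning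
  -- elements.
  have key : ∀ x : R, x * a ∈ S → x * b ∈ S → x * (a * b) ∈ S → x ∈ S →
      ∀ y ∈ S, x * y ∈ S := by
    intro x h1 h2 h3 h4 y hy
    refine Submodule.span_induction ?_ ?_ ?_ ?_ hy
    · rintro z (rfl | rfl | rfl | rfl)
      · simpa using h4
      all_goals assumption
    · simp
    · intro z w _ _ hz hw
      rw [mul_add]
      exact S.add_mem hz hw
    · intro c z _ hz
      rw [mul_smul_comm]
      exact S.smul_mem c hz
  have ka : ∀ y ∈ S, a * y ∈ S := by
    refine key a ?_ mab ?_ ma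
    · rw [ha]
      exact S.sub_mem (S.smul_mem _ ma) m1
    · rw [← mul_assoc, ha, sub_mul, smul_mul_assoc, one_mul]
      exact S.sub_mem (S.smul_mem _ mab) mb
  have mbb : b * b ∈ S := by
    rw [hb]
    exact S.sub_mem (S.smul_mem _ mb) m1
  have kb : ∀ y ∈ S, b * y ∈ S := by
    refine key b ?_ mbb ?_ mb
    · rw [hab]
      exact S.sub_mem (S.add_mem (S.add_mem (S.smul_mem _ mb) (S.smul_mem _ ma))
        (S.smul_mem _ m1)) mab
    -- Regrouped as $(ba)b$; expanding $ba$ leaves the term $ab^2$, which is where `ka` is needed.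
    · rw [← mul_assoc, hab]
      simp only [sub_mul, add_mul, smul_mul_assoc, one_mul, mul_assoc]
      exact S.sub_mem (S.add_mem (S.add_mem (S.smul_mem _ mbb) (S.smul_mem _ mab))
        (S.smul_mem _ mb)) (ka _ mbb)
  have kall : ∀ x ∈ Algebra.adjoin k {a, b}, ∀ y ∈ S, x * y ∈ S := by
    intro x hx
    induction hx using Algebra.adjoin_induction with
    | mem x hx =>
      rcases hx with rfl | rfl
      · exact ka
      · exact kb
    | algebraMap r =>
      intro y hy
      rw [← Algebra.smul_def]
      exact S.smul_mem _ hy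
    | add x z _ _ hx hz =>
      intro y hy
      rw [add_mul]
      exact S.add_mem (hx y hy) (hz y hy)
    | mul x z _ _ hx hz =>
      intro y hy
      rw [mul_assoc]
      exact hx _ (hz y hy)
  intro x hx
  simpa using kall x hx 1 m1

theorem finrank_span_four_le {k V : Type*} [Field k] [AddCommGroup V] [Module k V]
    (x y z w : V) : Module.finrank k (Submodule.span k {x, y, z, w}) ≤ 4 := by
  classical
  have h := finrank_span_finset_le_card (R := k) ({x, y, z, w} : Finset V)
  have e : (({x, y, z, w} : Finset V) : Set V) = {x, y, z, w} := by simp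
  rw [Set.finrank, e] at h
  exact h.trans Finset.card_le_four

end Algebra

/-! ### Trace identities and words in $\mathrm{SL}_2$ -/

section SL2

variable {k : Type*} [Field k]

theorem Matrix.SpecialLinearGroup.mul_self_fin_two (A : SL2 k) :
    (A : Matrix (Fin 2) (Fin 2) k) * A = (A : Matrix (Fin 2) (Fin 2) k).trace • A.1 - 1 := by
  have h := A.2
  rw [det_fin_two] at h
  ext i j
  fin_cases i <;> fin_cases j <;> simp [mul_apply, trace_fin_two] <;>
    first | linear_combination -h | ring

/-- The polarised Cayley–Hamilton identity, valid without any condition on determinants. -/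
theorem Matrix.mul_swap_fin_two (A B : Matrix (Fin 2) (Fin 2) k) :
    B * A = A.trace • B + B.trace • A + ((A * B).trace - A.trace * B.trace) • 1 - A * B := by
  ext i j
  fin_cases i <;> fin_cases j <;> simp [mul_apply, trace_fin_two] <;> ring

/-- Cayley–Hamilton with determinant $1$. Inversion becomes an affine operation once the trace is
known, so subalgebras are closed under it. -/
theorem Matrix.SpecialLinearGroup.coe_inv_fin_two (A : SL2 k) :
    ((A⁻¹ : SL2 k) : Matrix (Fin 2) (Fin 2) k) =
      (A : Matrix (Fin 2) (Fin 2) k).trace • 1 - A.1 := by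
  ext i j
  rw [SpecialLinearGroup.SL2_inv_expl]
  fin_cases i <;> fin_cases j <;> simp [trace_fin_two]

theorem Matrix.SpecialLinearGroup.trace_inv_fin_two (A : SL2 k) :
    ((A⁻¹ : SL2 k) : Matrix (Fin 2) (Fin 2) k).trace = (A : Matrix (Fin 2) (Fin 2) k).trace := by
  rw [coe_inv_fin_two]
  simp [trace_fin_two]
  ring

theorem Matrix.SpecialLinearGroup.mem_center_fin_two_iff (z : SL2 k) :
    z ∈ Subgroup.center (SL2 k) ↔ z = 1 ∨ z = -1 := by
  rw [SpecialLinearGroup.mem_center_iff]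
  constructor
  · rintro ⟨r, hr, h⟩
    rw [Fintype.card_fin, sq_eq_one_iff] at hr
    refine hr.imp ?_ ?_ <;> rintro rfl <;> refine Subtype.ext (h.symm.trans ?_)
    · exact map_one _
    · rw [map_neg, map_one]
      rfl
  · rintro (rfl | rfl)
    · exact ⟨1, by simp, by simp⟩
    · exact ⟨-1, by simp, by rw [map_neg, map_one]; rfl⟩

theorem projPSL_eq_iff (g h : SL2 k) : projPSL k g = projPSL k h ↔ g = h ∨ g = -h := by
  rw [eq_comm, projPSL, QuotientGroup.mk'_apply, QuotientGroup.mk'_apply, QuotientGroup.eq,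
    SpecialLinearGroup.mem_center_fin_two_iff, inv_mul_eq_iff_eq_mul, inv_mul_eq_iff_eq_mul]
  simp

theorem projPSL_surjective : Function.Surjective (projPSL k) :=
  QuotientGroup.mk'_surjective _

theorem projPSL_neg (g : SL2 k) : projPSL k (-g) = projPSL k g :=
  (projPSL_eq_iff _ _).2 (Or.inr rfl)

/-- The special linear group elements lying in a subalgebra of the matrix algebra. -/
def Subalgebra.specialUnits (S : Subalgebra k (Matrix (Fin 2) (Fin 2) k)) : Subgroup (SL2 k) where
  carrier := {g | (g : Matrix (Fin 2) (Fin 2) k) ∈ S}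
  one_mem' := by simp [S.one_mem]
  mul_mem' := fun {g h} hg hh => by simpa using S.mul_mem hg hh
  inv_mem' := fun {g} hg => by
    change ((g⁻¹ : SL2 k) : Matrix (Fin 2) (Fin 2) k) ∈ S
    rw [SpecialLinearGroup.coe_inv_fin_two]
    exact S.sub_mem (S.smul_mem S.one_mem _) hg

/-- Two pairs in `SL₂(k)` with the same traces, the first of which generates the matrix algebra,
satisfy the same relations modulo `±1`. -/
theorem projPSL_lift_eq_one_of_trace_eq {A B A' B' : SL2 k}
    (hA : A.1.trace = A'.1.trace) (hB : B.1.trace = B'.1.trace)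
    (hAB : (A.1 * B.1).trace = (A'.1 * B'.1).trace)
    (htop : Algebra.adjoin k {A.1, B.1} = ⊤) (w : FreeGroup (Fin 2))
    (hw : projPSL k (FreeGroup.lift ![A, B] w) = 1) :
    projPSL k (FreeGroup.lift ![A', B'] w) = 1 := by
  let M := Matrix (Fin 2) (Fin 2) k
  let a : M × M := (A.1, A'.1)
  let b : M × M := (B.1, B'.1)
  let R := Algebra.adjoin k {a, b}
  have hle : Subalgebra.toSubmodule R ≤ Submodule.span k {1, a, b, a * b} := by
    refine Algebra.adjoin_pair_le_span_of_trace_relations (s := A.1.trace) (t := B.1.trace)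
      (u := (A.1 * B.1).trace - A.1.trace * B.1.trace) ?_ ?_ ?_
    · refine Prod.ext (SpecialLinearGroup.mul_self_fin_two A) ?_
      simpa [a, hA] using SpecialLinearGroup.mul_self_fin_two A'
    · refine Prod.ext (SpecialLinearGroup.mul_self_fin_two B) ?_
      simpa [b, hB] using SpecialLinearGroup.mul_self_fin_two B'
    · refine Prod.ext (Matrix.mul_swap_fin_two A.1 B.1) ?_
      rw [hA, hB, hAB]
      exact Matrix.mul_swap_fin_two A'.1 B'.1
  have hfin : Module.finrank k R ≤ 4 := by
    have : FiniteDimensional k (Submodule.span k ({1, a, b, a * b} : Set (M × M))) :=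
      FiniteDimensional.span_of_finite k (Set.toFinite _)
    exact (Submodule.finrank_mono hle).trans (finrank_span_four_le 1 a b (a * b))
  let f : R →ₐ[k] M := (AlgHom.fst k M M).comp R.val
  have hsurj : Function.Surjective f := by
    have : f.range = ⊤ := by
      rw [eq_top_iff, ← htop]
      refine Algebra.adjoin_le ?_
      rintro x (rfl | rfl)
      · exact ⟨⟨a, Algebra.subset_adjoin (by simp)⟩, rfl⟩
      · exact ⟨⟨b, Algebra.subset_adjoin (by simp)⟩, rfl⟩
    exact AlgHom.range_eq_top f |>.1 this
  -- `f` maps a space of dimension at most $4$ onto one of dimension $4$.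
  have hinj : Function.Injective f := by
    have h4 : Module.finrank k M = 4 := by simp [M, Module.finrank_matrix]
    have h4' := LinearMap.finrank_le_finrank_of_surjective (f := f.toLinearMap) hsurj
    exact (LinearMap.injective_iff_surjective_of_finrank_eq_finrank (f := f.toLinearMap)
      (by omega)).2 hsurj
  have hmem : ∀ w, (((FreeGroup.lift ![A, B] w).1, (FreeGroup.lift ![A', B'] w).1) : M × M) ∈
      R := by
    intro w
    induction w using FreeGroup.induction_on with
    | C1 => exact R.one_mem
    | of i =>
      fin_cases i
      · exact Algebra.subset_adjoin (by simp [a])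
      · exact Algebra.subset_adjoin (by simp [b])
    -- Both components of the inverse are formed with the same scalar, because the traces agree.
    | inv_of i h =>
      have ht : ∀ i : Fin 2, (![A', B'] i).1.trace = (![A, B] i).1.trace := by
        intro i
        fin_cases i
        · exact hA.symm
        · exact hB.symm
      rw [map_inv, map_inv, SpecialLinearGroup.coe_inv_fin_two, SpecialLinearGroup.coe_inv_fin_two]
      simp only [FreeGroup.lift_apply_of] at h ⊢
      rw [ht]
      exact R.sub_mem (R.smul_mem R.one_mem (![A, B] i).1.trace) h
    | mul x y hx hy =>
      simpa using R.mul_mem hx hy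
  rw [← map_one (projPSL k), projPSL_eq_iff] at hw ⊢
  refine hw.imp (fun h => ?_) fun h => ?_
  · have := @hinj ⟨_, hmem w⟩ 1 (by simp [f, h])
    exact Subtype.ext (congrArg (fun x : R => x.1.2) this)
  · have := @hinj ⟨_, hmem w⟩ (-1) (by simp [f, h])
    exact Subtype.ext (congrArg (fun x : R => x.1.2) this)

/-- A pair generating the matrix algebra does not commute. -/
theorem not_commute_of_adjoin_eq_top {A B : Matrix (Fin 2) (Fin 2) k}
    (htop : Algebra.adjoin k {A, B} = ⊤) : ¬ Commute A B := by
  intro h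
  have := Algebra.isMulCommutative_adjoin k (s := {A, B}) (by
    rintro x (rfl | rfl) y (rfl | rfl)
    exacts [rfl, h, h.symm, rfl])
  have hm : ∀ x, x ∈ Algebra.adjoin k {A, B} := fun x => htop ▸ Algebra.mem_top
  have := congrArg Subtype.val (mul_comm' (⟨!![0, 1; 0, 0], hm _⟩ : Algebra.adjoin k {A, B})
    ⟨!![0, 0; 1, 0], hm _⟩)
  have := congrFun (congrFun this 0) 0
  simp at this

/-- The trace of an element of `SL₂(k)` of projective order `2` vanishes. -/
theorem trace_eq_zero_of_orderOf_projPSL_eq_two {g : SL2 k} (h : orderOf (projPSL k g) = 2) :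
    g.1.trace = 0 := by
  by_contra ht
  have h2 : projPSL k (g * g) = projPSL k 1 := by
    rw [map_mul, map_one, ← sq]
    exact orderOf_dvd_iff_pow_eq_one.1 h.dvd
  have hsq := SpecialLinearGroup.mul_self_fin_two g
  -- From $g^2=\pm1$ and $g^2=(\mathrm{tr}\,g)g-1$, a nonzero trace would make $g$ scalar, hence
  -- trivial in $\mathrm{PSL}_2$.
  have hg : ∃ r : k, g.1 = r • 1 := by
    rcases (projPSL_eq_iff _ _).1 h2 with e | e
    · have e' : g.1 * g.1 = 1 := congrArg Subtype.val e
      refine ⟨2 / g.1.trace, ?_⟩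
      rw [e'] at hsq
      have : g.1.trace • g.1 = (2 : k) • 1 := by
        rw [two_smul]
        exact (sub_eq_iff_eq_add.1 hsq.symm)
      rw [div_eq_inv_mul, mul_smul, ← this, smul_smul, inv_mul_cancel₀ ht, one_smul]
    · have e' : g.1 * g.1 = -1 := congrArg Subtype.val e
      refine ⟨0, ?_⟩
      rw [e'] at hsq
      have : g.1.trace • g.1 = 0 := by simpa using (sub_eq_iff_eq_add.1 hsq.symm)
      simpa [ht] using this
  have hc : projPSL k g = projPSL k 1 := by
    rw [map_one]
    obtain ⟨r, hr⟩ := hg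
    refine (QuotientGroup.eq_one_iff g).2 (Subgroup.mem_center_iff.2 fun x => Subtype.ext ?_)
    simp [hr]
  rw [hc, map_one, orderOf_one] at h
  omega

end SL2

/-! ### Reduction of the quaternion order modulo the prime -/

section Reduction

namespace HyperbolicTriple

variable (τ : HyperbolicTriple) {k : Type*} [Field k] [Algebra (𝓞 τ.traceField) k]
  (φ : τ.quaternionOrder →ₐ[𝓞 τ.traceField] Matrix (Fin 2) (Fin 2) k)

theorem toOrder_mul (γ δ : τ.extendedTriangleGroup) :
    τ.toOrder (γ * δ) = τ.toOrder γ * τ.toOrder δ :=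
  rfl

theorem toOrder_one : τ.toOrder 1 = 1 :=
  rfl

variable {φ}

/-- A subalgebra containing the reduction of the triangle group is everything. -/
theorem eq_top_of_forall_toOrder_mem (hφ : Function.Surjective φ)
    {S : Subalgebra k (Matrix (Fin 2) (Fin 2) k)} (hS : ∀ γ, φ (τ.toOrder γ) ∈ S) : S = ⊤ := by
  have h : ∀ x : Matrix (Fin 2) (Fin 2) ℝ, ∀ hx : x ∈ τ.quaternionOrder, φ ⟨x, hx⟩ ∈ S := by
    intro x hx
    induction hx using Algebra.adjoin_induction with
    | mem x hx =>
      obtain ⟨g, hg, rfl⟩ := hx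
      exact hS ⟨g, hg⟩
    | algebraMap r =>
      have : φ ⟨algebraMap _ _ r, Subalgebra.algebraMap_mem _ r⟩
          = algebraMap k _ (algebraMap (𝓞 τ.traceField) k r) := by
        rw [← IsScalarTower.algebraMap_apply]
        exact φ.commutes r
      exact this ▸ S.algebraMap_mem _
    | add x y hx hy h1 h2 =>
      have : φ ⟨x + y, add_mem hx hy⟩ = φ ⟨x, hx⟩ + φ ⟨y, hy⟩ := map_add φ ⟨x, hx⟩ ⟨y, hy⟩
      exact this ▸ S.add_mem h1 h2
    | mul x y hx hy h1 h2 =>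
      have : φ ⟨x * y, mul_mem hx hy⟩ = φ ⟨x, hx⟩ * φ ⟨y, hy⟩ := map_mul φ ⟨x, hx⟩ ⟨y, hy⟩
      exact this ▸ S.mul_mem h1 h2
  refine Algebra.eq_top_iff.2 fun y => ?_
  obtain ⟨x, rfl⟩ := hφ y
  exact h x x.2

/-- Elements of the extended triangle group with non-scalar reduction have determinant `1`. -/
theorem det_reduction_of_not_scalar (hφ : Function.Surjective φ) (γ : τ.extendedTriangleGroup)
    (hγ : φ (τ.toOrder γ) ∉ (⊥ : Subalgebra k (Matrix (Fin 2) (Fin 2) k))) :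
    (φ (τ.toOrder γ)).det = 1 := by
  set B := φ (τ.toOrder γ) with hB
  set B' := φ (τ.toOrder γ⁻¹) with hB'
  have h1 : B * B' = 1 := by
    rw [hB, hB', ← map_mul, ← toOrder_mul, mul_inv_cancel, toOrder_one, map_one]
  -- In $\mathrm M_2(\mathbb R)$ the sum $\gamma+\gamma^{-1}$ is the scalar $\mathrm{tr}\,\gamma$,
  -- hence central in the order; surjectivity of `φ` carries centrality over to $\mathrm M_2(k)$.
  have hcomm : ∀ M, Commute M (B + B') := by
    intro M
    obtain ⟨y, rfl⟩ := hφ M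
    rw [hB, hB', ← map_add]
    refine Commute.map ?_ φ
    refine Subtype.ext ?_
    change y.1 * ((γ : SL2 ℝ).1 + ((γ : SL2 ℝ)⁻¹).1) = ((γ : SL2 ℝ).1 + ((γ : SL2 ℝ)⁻¹).1) * y.1
    rw [SpecialLinearGroup.coe_inv_fin_two, add_sub_cancel]
    simp
  obtain ⟨r, hr⟩ := mem_range_scalar_iff_commute_single'.2 fun i j => hcomm (single i j 1)
  have h2 : B * B = r • B - 1 := by
    have : B' = r • 1 - B := by
      rw [eq_sub_iff_add_eq, add_comm, ← hr]
      simp [scalar_apply, smul_one_eq_diagonal]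
    rw [this, mul_sub, mul_smul_comm, mul_one] at h1
    rw [← h1]
    abel
  have h3 : B * B = B.trace • B - B.det • 1 := by
    ext i j
    fin_cases i <;> fin_cases j <;> simp [mul_apply, trace_fin_two, det_fin_two] <;> ring
  -- Two monic quadratic equations for `B` are compared; for non-scalar `B` they must coincide.
  have h4 : (r - B.trace) • B = (1 - B.det) • 1 := by
    rw [sub_smul, sub_smul, one_smul, sub_eq_sub_iff_add_eq_add]
    rw [h2, sub_eq_sub_iff_add_eq_add] at h3
    rw [h3, add_comm]
  by_cases hrt : r - B.trace = 0
  · rw [hrt, zero_smul] at h4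
    have := congrFun (congrFun h4 0) 0
    simp at this
    linear_combination this
  · refine absurd (Algebra.mem_bot.2 ⟨(r - B.trace)⁻¹ * (1 - B.det), ?_⟩) hγ
    rw [Algebra.algebraMap_eq_smul_one, mul_smul, ← h4, smul_smul, inv_mul_cancel₀ hrt, one_smul]

/-- The reduction of the extended triangle group has determinant `1`. -/
theorem det_reduction (hφ : Function.Surjective φ) (γ : τ.extendedTriangleGroup) :
    (φ (τ.toOrder γ)).det = 1 := by
  by_cases hγ : φ (τ.toOrder γ) ∈ (⊥ : Subalgebra k (Matrix (Fin 2) (Fin 2) k))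
  swap
  · exact τ.det_reduction_of_not_scalar hφ γ hγ
  -- For scalar reduction of `γ`, both `δ` and `γ * δ` reduce to non-scalars, and the determinant is
  -- multiplicative.
  obtain ⟨δ, hδ⟩ : ∃ δ, φ (τ.toOrder δ) ∉ (⊥ : Subalgebra k (Matrix (Fin 2) (Fin 2) k)) := by
    by_contra! h
    have htop := τ.eq_top_of_forall_toOrder_mem hφ h
    have hm : !![0, 1; 0, 0] ∈ (⊥ : Subalgebra k (Matrix (Fin 2) (Fin 2) k)) :=
      htop ▸ Algebra.mem_top
    obtain ⟨r, hr⟩ := Algebra.mem_bot.1 hm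
    have := congrFun (congrFun hr 0) 1
    simp [Algebra.algebraMap_eq_smul_one] at this
  have hγδ : φ (τ.toOrder (γ * δ)) ∉ (⊥ : Subalgebra k (Matrix (Fin 2) (Fin 2) k)) := by
    intro h
    refine hδ ?_
    obtain ⟨r, hr⟩ := Algebra.mem_bot.1 hγ
    have h1 : φ (τ.toOrder γ⁻¹) * φ (τ.toOrder γ) = 1 := by
      rw [← map_mul, ← toOrder_mul, inv_mul_cancel, toOrder_one, map_one]
    have hr0 : r ≠ 0 := by
      rintro rfl
      rw [← hr, map_zero, mul_zero] at h1
      exact zero_ne_one h1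
    rw [toOrder_mul, map_mul, ← hr, Algebra.algebraMap_eq_smul_one, smul_mul_assoc, one_mul] at h
    have := Subalgebra.smul_mem _ h r⁻¹
    rwa [smul_smul, inv_mul_cancel₀ hr0, one_smul] at this
  have h1 := τ.det_reduction_of_not_scalar hφ _ hγδ
  rwa [toOrder_mul, map_mul, det_mul, τ.det_reduction_of_not_scalar hφ _ hδ, mul_one] at h1

/-- Lifts of a generating triple of `K(τ; p)` generate the matrix algebra. -/
theorem adjoin_eq_top_of_generates (hφ : Function.Surjective φ) {γ : Fin 3 → PSL2 k}
    (hprod : γ 0 * γ 1 * γ 2 = 1)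
    (hgen : Subgroup.closure (Set.range γ) = τ.quotientGroup φ) {A B : SL2 k}
    (hA : projPSL k A = γ 0) (hB : projPSL k B = γ 1) : Algebra.adjoin k {A.1, B.1} = ⊤ := by
  set S := Algebra.adjoin k {A.1, B.1} with hS
  have hAS : A ∈ S.specialUnits := Algebra.subset_adjoin (by simp)
  have hBS : B ∈ S.specialUnits := Algebra.subset_adjoin (by simp)
  have hK : τ.quotientGroup φ ≤ S.specialUnits.map (projPSL k) := by
    rw [← hgen, Subgroup.closure_le]
    rintro _ ⟨i, rfl⟩
    fin_cases i
    · exact ⟨A, hAS, hA⟩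
    · exact ⟨B, hBS, hB⟩
    · refine ⟨(A * B)⁻¹, inv_mem (mul_mem hAS hBS), ?_⟩
      rw [map_inv, map_mul, hA, hB]
      exact inv_eq_of_mul_eq_one_right hprod
  refine τ.eq_top_of_forall_toOrder_mem hφ fun γ => ?_
  -- `quotientGroup` only sees elements whose reduction lies in $\mathrm{SL}_2(k)$; `det_reduction`
  -- ensures that none is missed.
  obtain ⟨g, hg, h⟩ := hK (Subgroup.subset_closure
    ⟨γ, ⟨φ (τ.toOrder γ), τ.det_reduction hφ γ⟩, rfl, rfl⟩)
  rcases (projPSL_eq_iff _ _).1 h with h | h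
  · have h' : φ (τ.toOrder γ) = g.1 := (congrArg Subtype.val h).symm
    exact h' ▸ hg
  · have h' : φ (τ.toOrder γ) = -g.1 := by
      rw [h]
      exact (neg_neg _).symm
    exact h' ▸ S.neg_mem hg

/-- No component of a generating triple of `K(τ; p)` is trivial. -/
theorem ne_one_of_generates (hφ : Function.Surjective φ) {γ : Fin 3 → PSL2 k}
    (hprod : γ 0 * γ 1 * γ 2 = 1)
    (hgen : Subgroup.closure (Set.range γ) = τ.quotientGroup φ) (i : Fin 3) : γ i ≠ 1 := by
  intro hi
  obtain ⟨A, hA⟩ := projPSL_surjective (γ 0)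
  obtain ⟨B, hB⟩ := projPSL_surjective (γ 1)
  -- If one component is trivial, then `A`, `B` or `A * B` is central, so `A` and `B` commute.
  refine not_commute_of_adjoin_eq_top (τ.adjoin_eq_top_of_generates hφ hprod hgen hA hB) ?_
  suffices h : Commute A B from congrArg Subtype.val h
  have hc : ∀ {g : SL2 k}, projPSL k g = 1 → ∀ h, Commute g h := fun {g} hg h =>
    (Subgroup.mem_center_iff.1 ((QuotientGroup.eq_one_iff g).1 hg) h).symm
  fin_cases i
  · exact hc (hA.trans hi) B
  · exact (hc (hB.trans hi) A).symm
  · have h1 : projPSL k (A * B) = 1 := by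
      have hi' : γ 2 = 1 := hi
      rw [map_mul, hA, hB, ← hprod, hi', mul_one]
    have h2 := hc h1 A
    have h3 : A * (B * A) = A * (A * B) := by
      simpa only [mul_assoc] using h2.eq
    exact (mul_left_cancel h3).symm

end HyperbolicTriple

end Reduction

/-! ### Lifts with chosen traces and the remaining sign -/

section Traces

variable {k : Type*} [Field k]

theorem trace_eq_or_eq_neg_of_mk_projPSL_eq {g h : SL2 k}
    (e : ConjClasses.mk (projPSL k g) = ConjClasses.mk (projPSL k h)) :
    g.1.trace = h.1.trace ∨ g.1.trace = -h.1.trace := by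
  obtain ⟨c, hc⟩ := isConj_iff.1 (ConjClasses.mk_eq_mk_iff_isConj.1 e)
  obtain ⟨c, rfl⟩ := projPSL_surjective c
  rw [← map_inv, ← map_mul, ← map_mul] at hc
  have ht : (c * g * c⁻¹).1.trace = g.1.trace := by
    change (c.1 * g.1 * (c⁻¹).1).trace = _
    have hcc : (c⁻¹).1 * c.1 = 1 := congrArg Subtype.val (inv_mul_cancel c)
    rw [trace_mul_cycle, hcc, one_mul]
  rw [← ht]
  rcases (projPSL_eq_iff _ _).1 hc with h' | h'
  · exact Or.inl (by rw [h'])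
  · exact Or.inr (by rw [h']; exact trace_neg _)

/-- A chosen trace of a conjugacy class of `PSL₂(k)`. -/
noncomputable def classTrace (C : ConjClasses (PSL2 k)) : k :=
  (Function.surjInv projPSL_surjective (Quotient.out C) : SL2 k).1.trace

theorem trace_eq_classTrace_or_eq_neg {g : SL2 k} {C : ConjClasses (PSL2 k)}
    (h : ConjClasses.mk (projPSL k g) = C) :
    g.1.trace = classTrace C ∨ g.1.trace = -classTrace C := by
  refine trace_eq_or_eq_neg_of_mk_projPSL_eq (h.trans ?_)
  exact (Quotient.out_eq C).symm.trans
    (congrArg ConjClasses.mk (Function.surjInv_eq projPSL_surjective _).symm)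

theorem trace_neg_specialLinear (g : SL2 k) : (-g).1.trace = -g.1.trace :=
  trace_neg _

theorem exists_lift_trace_eq_classTrace (γ : PSL2 k) :
    ∃ g : SL2 k, projPSL k g = γ ∧ g.1.trace = classTrace (ConjClasses.mk γ) := by
  obtain ⟨g, rfl⟩ := projPSL_surjective γ
  rcases trace_eq_classTrace_or_eq_neg (g := g) rfl with h | h
  · exact ⟨g, rfl, h⟩
  · exact ⟨-g, projPSL_neg g, by rw [trace_neg_specialLinear, h, neg_neg]⟩

/-- The triple `γ` has a lift whose traces are the chosen ones, up to a sign `e` on the last. -/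
def HasLiftWithTraces (γ : Fin 3 → PSL2 k) (e : k) : Prop :=
  ∃ A B : SL2 k, projPSL k A = γ 0 ∧ projPSL k B = γ 1 ∧
    A.1.trace = classTrace (ConjClasses.mk (γ 0)) ∧
    B.1.trace = classTrace (ConjClasses.mk (γ 1)) ∧
    (A.1 * B.1).trace = e * classTrace (ConjClasses.mk (γ 2))

theorem hasLiftWithTraces_one_or_neg_one {γ : Fin 3 → PSL2 k} (h : γ 0 * γ 1 * γ 2 = 1) :
    HasLiftWithTraces γ 1 ∨ HasLiftWithTraces γ (-1) := by
  obtain ⟨A, hA, tA⟩ := exists_lift_trace_eq_classTrace (γ 0)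
  obtain ⟨B, hB, tB⟩ := exists_lift_trace_eq_classTrace (γ 1)
  have h2 : projPSL k (A * B)⁻¹ = γ 2 := by
    rw [map_inv, map_mul, hA, hB]
    exact inv_eq_of_mul_eq_one_right h
  have h3 := trace_eq_classTrace_or_eq_neg (congrArg ConjClasses.mk h2)
  rw [SpecialLinearGroup.trace_inv_fin_two] at h3
  change (A.1 * B.1).trace = _ ∨ (A.1 * B.1).trace = _ at h3
  exact h3.imp (fun h3 => ⟨A, B, hA, hB, tA, tB, by rw [h3, one_mul]⟩)
    fun h3 => ⟨A, B, hA, hB, tA, tB, by rw [h3, neg_one_mul]⟩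

/-- If some component has order `2`, the sign can be absorbed. -/
theorem hasLiftWithTraces_one_of_orderOf_eq_two {γ : Fin 3 → PSL2 k} (h : γ 0 * γ 1 * γ 2 = 1)
    {i : Fin 3} (hi : orderOf (γ i) = 2) : HasLiftWithTraces γ 1 := by
  have h0 : classTrace (ConjClasses.mk (γ i)) = 0 := by
    obtain ⟨g, hg, ht⟩ := exists_lift_trace_eq_classTrace (γ i)
    rw [← ht]
    exact trace_eq_zero_of_orderOf_projPSL_eq_two (hg ▸ hi)
  rcases hasLiftWithTraces_one_or_neg_one h with h' | ⟨A, B, hA, hB, tA, tB, tAB⟩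
  · exact h'
  -- Negating a lift of trace $0$ keeps its trace and flips that of the product; if the third trace
  -- is $0$, the sign is immaterial.
  fin_cases i <;> dsimp only [Fin.zero_eta, Fin.mk_one, Fin.reduceFinMk] at h0
  · refine ⟨-A, B, (projPSL_neg A).trans hA, hB, ?_, tB, ?_⟩
    · rw [trace_neg_specialLinear, tA, h0, neg_zero]
    · change (-A.1 * B.1).trace = _
      rw [neg_mul, trace_neg, tAB]
      ring
  · refine ⟨A, -B, hA, (projPSL_neg B).trans hB, tA, ?_, ?_⟩
    · rw [trace_neg_specialLinear, tB, h0, neg_zero]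
    · change (A.1 * -B.1).trace = _
      rw [mul_neg, trace_neg, tAB]
      ring
  · refine ⟨A, B, hA, hB, tA, tB, ?_⟩
    rw [tAB, h0, mul_zero, mul_zero]

end Traces

/-! ### Homomorphisms from the triangle group and their kernels -/

namespace HyperbolicTriple

variable (τ : HyperbolicTriple) {k : Type*} [Field k] [Algebra (𝓞 τ.traceField) k]
  {φ : τ.quaternionOrder →ₐ[𝓞 τ.traceField] Matrix (Fin 2) (Fin 2) k}

/-- The images of the generators under a homomorphism from the triangle group, together with the
inverse of their product. -/
def imageTriple {G : Type*} [Group G] (f : τ.TriangleGroup →* G) : Fin 3 → G :=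
  ![f (PresentedGroup.of 0), f (PresentedGroup.of 1),
    (f (PresentedGroup.of 0) * f (PresentedGroup.of 1))⁻¹]

section

variable {τ} {G : Type*} [Group G] (f : τ.TriangleGroup →* G)

theorem imageTriple_prod : τ.imageTriple f 0 * τ.imageTriple f 1 * τ.imageTriple f 2 = 1 :=
  mul_inv_cancel _

theorem closure_range_imageTriple : Subgroup.closure (Set.range (τ.imageTriple f)) = f.range := by
  apply le_antisymm
  · rw [Subgroup.closure_le]
    rintro _ ⟨i, rfl⟩
    fin_cases i
    · exact ⟨_, rfl⟩
    · exact ⟨_, rfl⟩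
    · exact inv_mem (mul_mem ⟨_, rfl⟩ ⟨_, rfl⟩)
  · rw [MonoidHom.range_eq_map, ← PresentedGroup.closure_range_of, MonoidHom.map_closure,
      Subgroup.closure_le]
    rintro _ ⟨_, ⟨i, rfl⟩, rfl⟩
    refine Subgroup.subset_closure ?_
    fin_cases i
    · exact ⟨0, rfl⟩
    · exact ⟨1, rfl⟩

theorem imageTriple_zero_pow : τ.imageTriple f 0 ^ τ.a = 1 := by
  have h : (PresentedGroup.of 0 : τ.TriangleGroup) ^ τ.a = 1 :=
    PresentedGroup.one_of_mem (x := FreeGroup.of 0 ^ τ.a) (by simp [triangleRels])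
  exact (map_pow f _ _).symm.trans (by rw [h, map_one])

theorem imageTriple_one_pow : τ.imageTriple f 1 ^ τ.b = 1 := by
  have h : (PresentedGroup.of 1 : τ.TriangleGroup) ^ τ.b = 1 :=
    PresentedGroup.one_of_mem (x := FreeGroup.of 1 ^ τ.b) (by simp [triangleRels])
  exact (map_pow f _ _).symm.trans (by rw [h, map_one])

theorem imageTriple_two_pow : τ.imageTriple f 2 ^ τ.c = 1 := by
  have h : (PresentedGroup.of 0 * PresentedGroup.of 1 : τ.TriangleGroup) ^ τ.c = 1 :=
    PresentedGroup.one_of_mem (x := (FreeGroup.of 0 * FreeGroup.of 1) ^ τ.c)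
      (by simp [triangleRels])
  change (_)⁻¹ ^ τ.c = 1
  rw [inv_pow, ← map_mul, ← map_pow, h, map_one, inv_one]

end

variable {τ}

theorem projPSL_lift_eq {K : Type*} [Field K] {f : τ.TriangleGroup →* PSL2 K} {A B : SL2 K}
    (hA : projPSL K A = τ.imageTriple f 0) (hB : projPSL K B = τ.imageTriple f 1)
    (w : FreeGroup (Fin 2)) :
    projPSL K (FreeGroup.lift ![A, B] w) = f (PresentedGroup.mk _ w) := by
  suffices h : (projPSL K).comp (FreeGroup.lift ![A, B]) = f.comp (PresentedGroup.mk _) from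
    DFunLike.congr_fun h w
  ext i
  fin_cases i
  · exact (congrArg _ FreeGroup.lift_apply_of).trans hA
  · exact (congrArg _ FreeGroup.lift_apply_of).trans hB

/-- The chosen traces depend only on the classes, so equal classes and a common sign `e` give lifted
pairs with the same three traces. Every relation of the first pair modulo $\pm1$ then holds for the
second. -/
theorem ker_le_ker_of_hasLiftWithTraces (hφ : Function.Surjective φ)
    {f f' : τ.TriangleGroup →* PSL2 k} (hf : f.range = τ.quotientGroup φ)
    (hC : ∀ i, ConjClasses.mk (τ.imageTriple f i) = ConjClasses.mk (τ.imageTriple f' i)) {e : k}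
    (h : HasLiftWithTraces (τ.imageTriple f) e) (h' : HasLiftWithTraces (τ.imageTriple f') e) :
    f.ker ≤ f'.ker := by
  obtain ⟨A, B, hA, hB, tA, tB, tAB⟩ := h
  obtain ⟨A', B', hA', hB', tA', tB', tAB'⟩ := h'
  have htop := τ.adjoin_eq_top_of_generates hφ (imageTriple_prod f)
    ((closure_range_imageTriple f).trans hf) hA hB
  intro x hx
  obtain ⟨w, rfl⟩ := PresentedGroup.mk_surjective _ x
  rw [MonoidHom.mem_ker] at hx ⊢
  rw [← projPSL_lift_eq hA' hB']
  rw [← projPSL_lift_eq hA hB] at hx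
  refine projPSL_lift_eq_one_of_trace_eq ?_ ?_ ?_ htop w hx
  · rw [tA, tA', hC]
  · rw [tB, tB', hC]
  · rw [tAB, tAB', hC]

theorem exists_hom_of_mem_normalSubgroups {H : Subgroup τ.TriangleGroup}
    (hH : H ∈ τ.normalSubgroups φ) :
    ∃ f : τ.TriangleGroup →* PSL2 k, f.ker = H ∧ f.range = τ.quotientGroup φ := by
  obtain ⟨_, ⟨e⟩⟩ := hH
  refine ⟨(τ.quotientGroup φ).subtype.comp (e.toMonoidHom.comp (QuotientGroup.mk' H)), ?_, ?_⟩
  · ext x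
    simp [MonoidHom.mem_ker]
  · ext x
    simp only [MonoidHom.mem_range]
    constructor
    · rintro ⟨y, rfl⟩
      exact (e (QuotientGroup.mk' H y)).2
    · intro hx
      obtain ⟨y, hy⟩ := QuotientGroup.mk'_surjective H (e.symm ⟨x, hx⟩)
      refine ⟨y, ?_⟩
      change (e (QuotientGroup.mk' H y)).1 = x
      rw [hy, e.apply_symm_apply]

theorem mk_imageTriple_mem_classTriples {f : τ.TriangleGroup →* PSL2 k}
    (hf : f.range = τ.quotientGroup φ) :
    (fun i => ConjClasses.mk (τ.imageTriple f i)) ∈ τ.classTriples φ :=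
  have hgen := (closure_range_imageTriple f).trans hf
  ⟨τ.imageTriple f, ⟨imageTriple_prod f, fun _ => rfl, hgen⟩, imageTriple_zero_pow f,
    imageTriple_one_pow f, imageTriple_two_pow f, imageTriple_prod f, hgen⟩

/-- Needed so that a least order other than $2$ exceeds $2$. -/
theorem classOrder_ne_one_of_mem_classTriples (hφ : Function.Surjective φ)
    {C : Fin 3 → ConjClasses (PSL2 k)} (hC : C ∈ τ.classTriples φ) (i : Fin 3) :
    classOrder (C i) ≠ 1 := by
  obtain ⟨γ, ⟨hprod, hγ, hgen⟩, -⟩ := hC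
  rw [← hγ i]
  exact fun h => τ.ne_one_of_generates hφ hprod hgen i (orderOf_eq_one_iff.1 h)

/-- The normal subgroups inject into pairs of a triple of classes and a sign; the sign is trivial
when an order is `2`. -/
theorem exists_injOn_normalSubgroups (hφ : Function.Surjective φ) :
    ∃ F : Subgroup τ.TriangleGroup → (Fin 3 → ConjClasses (PSL2 k)) × Bool,
      Set.InjOn F (τ.normalSubgroups φ) ∧ ∀ H ∈ τ.normalSubgroups φ,
        (F H).1 ∈ τ.classTriples φ ∧ ∀ i, classOrder ((F H).1 i) = 2 → (F H).2 = true := by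
  classical
  -- Any homomorphism with kernel `H` and the right image will do; injectivity survives the choice
  -- because the data recover the kernel.
  choose! f hker hrange using fun H (hH : H ∈ τ.normalSubgroups φ) =>
    exists_hom_of_mem_normalSubgroups hH
  refine ⟨fun H => (fun i => ConjClasses.mk (τ.imageTriple (f H) i),
    decide (HasLiftWithTraces (τ.imageTriple (f H)) 1)), ?_, fun H hH => ⟨?_, fun i hi => ?_⟩⟩
  · intro H hH H' hH' h
    obtain ⟨hC, hs⟩ := Prod.ext_iff.1 h
    have hC := fun i => congrFun hC i
    rw [decide_eq_decide] at hs
    obtain ⟨e, he, he'⟩ : ∃ e : k, HasLiftWithTraces (τ.imageTriple (f H)) e ∧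
        HasLiftWithTraces (τ.imageTriple (f H')) e := by
      by_cases h1 : HasLiftWithTraces (τ.imageTriple (f H)) 1
      · exact ⟨1, h1, hs.1 h1⟩
      · exact ⟨-1, (hasLiftWithTraces_one_or_neg_one (imageTriple_prod _)).resolve_left h1,
          (hasLiftWithTraces_one_or_neg_one (imageTriple_prod _)).resolve_left
            fun h => h1 (hs.2 h)⟩
    rw [← hker H hH, ← hker H' hH']
    exact le_antisymm (ker_le_ker_of_hasLiftWithTraces hφ (hrange H hH) hC he he')
      (ker_le_ker_of_hasLiftWithTraces hφ (hrange H' hH') (fun i => (hC i).symm) he' he)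
  · exact mk_imageTriple_mem_classTriples (hrange H hH)
  · exact decide_eq_true (hasLiftWithTraces_one_of_orderOf_eq_two (imageTriple_prod _) hi)

end HyperbolicTriple

/-! ### Counting class triples by their orders -/

section Counting

theorem sortTriple_zero_eq (f : Fin 3 → ℕ) : ∃ i, sortTriple f 0 = f i :=
  ⟨_, rfl⟩

theorem prod_sortTriple {M : Type*} [CommMonoid M] (f : Fin 3 → ℕ) (g : ℕ → M) :
    ∏ i, g (sortTriple f i) = ∏ i, g (f i) :=
  Equiv.prod_comp (Tuple.sort f) fun i => g (f i)

variable {k : Type*} [Field k]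

theorem classOrder_pos [Finite k] (C : ConjClasses (PSL2 k)) : 0 < classOrder C := by
  obtain ⟨g, rfl⟩ := ConjClasses.exists_rep C
  exact orderOf_pos g

theorem kappa_eq_ncard_classOrder (n : ℕ) :
    kappa n k = {C : ConjClasses (PSL2 k) | classOrder C = n}.ncard := by
  refine congrArg Set.ncard (Set.ext fun C => ?_)
  obtain ⟨g, rfl⟩ := ConjClasses.exists_rep C
  change (∀ h ∈ (ConjClasses.mk g).carrier, orderOf h = n) ↔ orderOf g = n
  refine ⟨fun h => h g ConjClasses.mem_carrier_mk, fun h x hx => ?_⟩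
  rw [← h]
  exact congrArg classOrder (ConjClasses.mem_carrier_iff_mk_eq.1 hx)

theorem ncard_classes_of_orders [Finite k] (f : Fin 3 → ℕ) :
    {C : Fin 3 → ConjClasses (PSL2 k) | (fun i => classOrder (C i)) = f}.ncard =
      ∏ i, kappa (f i) k := by
  classical
  have := Fintype.ofFinite (ConjClasses (PSL2 k))
  have h : {C : Fin 3 → ConjClasses (PSL2 k) | (fun i => classOrder (C i)) = f} =
      Fintype.piFinset fun i => Finset.univ.filter fun C : ConjClasses (PSL2 k) =>
        classOrder C = f i := by
    ext C
    simp [funext_iff]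
  rw [h, Set.ncard_coe_finset, Fintype.card_piFinset]
  refine Finset.prod_congr rfl fun i _ => ?_
  rw [kappa_eq_ncard_classOrder, ← Set.ncard_coe_finset]
  simp

namespace HyperbolicTriple

variable {τ : HyperbolicTriple} [Algebra (𝓞 τ.traceField) k]
  {φ : τ.quaternionOrder →ₐ[𝓞 τ.traceField] Matrix (Fin 2) (Fin 2) k}

/-- Sort the class triples by their unsorted order triple: `orderMultiplicity` of these occur, and
each contributes at most the same product of `kappa` values, since that product is invariant under
rearrangement. -/
theorem ncard_classTriples_sortTriple_le [Finite k] (ω : Fin 3 → ℕ) :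
    {C ∈ τ.classTriples φ | sortTriple (fun i => classOrder (C i)) = ω}.ncard ≤
      τ.orderMultiplicity φ ω * (kappa (ω 0) k * kappa (ω 1) k * kappa (ω 2) k) := by
  classical
  set S := {f : Fin 3 → ℕ | sortTriple f = ω ∧
    ∃ C ∈ τ.classTriples φ, (fun i => classOrder (C i)) = f} with hS
  have hfin : S.Finite :=
    (Set.toFinite
      ((fun C : Fin 3 → ConjClasses (PSL2 k) => fun i => classOrder (C i)) ''
        τ.classTriples φ)).subset fun f hf => hf.2
  have hsub : {C ∈ τ.classTriples φ | sortTriple (fun i => classOrder (C i)) = ω} ⊆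
      ⋃ f ∈ hfin.toFinset, {C | (fun i => classOrder (C i)) = f} := by
    rintro C ⟨hC, h⟩
    simp only [Set.Finite.mem_toFinset, Set.mem_iUnion]
    exact ⟨_, ⟨h, C, hC, rfl⟩, rfl⟩
  refine (Set.ncard_le_ncard hsub (Set.toFinite _)).trans ?_
  refine (Finset.set_ncard_biUnion_le _ _).trans ?_
  rw [orderMultiplicity, ← hS, Set.ncard_eq_toFinset_card S hfin, ← smul_eq_mul]
  refine Finset.sum_le_card_nsmul _ _ _ fun f hf => ?_
  have hf : sortTriple f = ω := ((Set.Finite.mem_toFinset _).1 hf).1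
  rw [ncard_classes_of_orders, ← prod_sortTriple f fun n => kappa n k, hf, Fin.prod_univ_three]

end HyperbolicTriple

end Counting

theorem mainTheorem2 (τ : HyperbolicTriple) (p : ℕ) (hp : p.Prime) (hp2 : 2 < p)
    {k : Type*} [Field k] [Finite k] [CharP k p]
    [Algebra (𝓞 τ.traceField) k]
    (hk : Function.Surjective (algebraMap (𝓞 τ.traceField) k))
    (φ : τ.quaternionOrder →ₐ[𝓞 τ.traceField] Matrix (Fin 2) (Fin 2) k)
    (hφ : Function.Surjective φ)
    (hC : ∀ C ∈ τ.classTriples φ,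
      IsPartlyProjectiveClass C ∧ ¬ IsExceptionalClass C ∧ classTraceField C = ⊤) :
    (τ.normalSubgroups φ).Finite ∧
    (τ.normalSubgroups φ).ncard ≤
      (∑ᶠ ω ∈ {ω | ω ∈ τ.orderTriples φ ∧ ω 0 = 2},
        τ.orderMultiplicity φ ω * (kappa (ω 0) k * kappa (ω 1) k * kappa (ω 2) k)) +
      ∑ᶠ ω ∈ {ω | ω ∈ τ.orderTriples φ ∧ 2 < ω 0},
        2 * τ.orderMultiplicity φ ω * (kappa (ω 0) k * kappa (ω 1) k * kappa (ω 2) k) := by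
  classical
  obtain ⟨F, hinj, hF⟩ := HyperbolicTriple.exists_injOn_normalSubgroups (τ := τ) hφ
  refine ⟨Set.Finite.of_finite_image (Set.toFinite _) hinj, ?_⟩
  have hΩ : (τ.orderTriples φ).Finite :=
    (Set.toFinite ((fun C => sortTriple fun i => classOrder (C i)) '' τ.classTriples φ)).subset
      fun ω ⟨C, hC, h⟩ => ⟨C, hC, h⟩
  have h2 : {ω | ω ∈ τ.orderTriples φ ∧ ω 0 = 2} = hΩ.toFinset.filter fun ω => ω 0 = 2 := by
    ext
    simp
  -- The least order is the order of some component, hence positive and not $1$; the two sums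
  -- therefore exhaust `orderTriples`.
  have h3 : {ω | ω ∈ τ.orderTriples φ ∧ 2 < ω 0} = hΩ.toFinset.filter fun ω => ¬ ω 0 = 2 := by
    ext ω
    simp only [Set.mem_ofPred_eq, Finset.coe_filter, Set.Finite.mem_toFinset]
    refine and_congr_right ?_
    rintro ⟨C, hC, rfl⟩
    obtain ⟨i, hi⟩ := sortTriple_zero_eq fun i => classOrder (C i)
    have h1 := HyperbolicTriple.classOrder_ne_one_of_mem_classTriples hφ hC i
    have h0 := classOrder_pos (C i)
    omega
  rw [h2, h3, finsum_mem_coe_finset, finsum_mem_coe_finset, ← hinj.ncard_image]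
  set T : (Fin 3 → ℕ) → Set (Fin 3 → ConjClasses (PSL2 k)) := fun ω =>
    {C ∈ τ.classTriples φ | sortTriple (fun i => classOrder (C i)) = ω} with hT
  -- The possible values of `F` over `ω`: one sign if the least order is $2$, both otherwise.
  set U : (Fin 3 → ℕ) → Set ((Fin 3 → ConjClasses (PSL2 k)) × Bool) := fun ω =>
    if ω 0 = 2 then T ω ×ˢ {true} else T ω ×ˢ Set.univ with hU
  have hsub : F '' τ.normalSubgroups φ ⊆ ⋃ ω ∈ hΩ.toFinset, U ω := by
    rintro _ ⟨H, hH, rfl⟩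
    obtain ⟨hC, hs⟩ := hF H hH
    simp only [Set.Finite.mem_toFinset, Set.mem_iUnion]
    refine ⟨_, ⟨_, hC, rfl⟩, ?_⟩
    simp only [hU]
    split_ifs with h
    · obtain ⟨i, hi⟩ := sortTriple_zero_eq fun i => classOrder ((F H).1 i)
      exact ⟨⟨hC, rfl⟩, hs i (hi ▸ h)⟩
    · exact ⟨⟨hC, rfl⟩, trivial⟩
  refine (Set.ncard_le_ncard hsub (Set.toFinite _)).trans ?_
  refine (Finset.set_ncard_biUnion_le _ _).trans ?_
  rw [← Finset.sum_filter_add_sum_filter_not _ fun ω : Fin 3 → ℕ => ω 0 = 2]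
  refine add_le_add (Finset.sum_le_sum fun ω hω => ?_) (Finset.sum_le_sum fun ω hω => ?_)
  · rw [hU]
    simp only [if_pos (Finset.mem_filter.1 hω).2, Set.ncard_prod, Set.ncard_singleton, mul_one]
    exact HyperbolicTriple.ncard_classTriples_sortTriple_le ω
  · rw [hU]
    simp only [if_neg (Finset.mem_filter.1 hω).2, Set.ncard_prod, Set.ncard_univ,
      Nat.card_eq_fintype_card, Fintype.card_bool]
    rw [mul_comm, mul_assoc]
    exact Nat.mul_le_mul_left 2 (HyperbolicTriple.ncard_classTriples_sortTriple_le ω)
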